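/- Let $\{\xi_{n,k}\}_{n\ge 1,\,1\le k\le n}$ be a triangular array of real square integrable random variables such that, for every $n\ge 1$, the variables $\xi_{n,1},\dots,\xi_{n,n}$ are defined on a common probability space and are independent, $\mathbb{E}[\xi_{n,k}]=0$ for all $1\le k\le n$, and $\sum_{k=1}^n \sigma_{n,k}^2 = 1$, where $\sigma_{n,k}^2=\mathbb{E}[\xi_{n,k}^2]$. Suppose that the array satisfies Feller's negligibility condition $\max_{1\le k\le n}\sigma_{n,k}^2\to 0$ as $n\to\infty$, and let $\xi$ be a standard normally distributed random variable. Then $$\limsup_{n\to\infty} K\Big(\xi,\sum_{k=1}^n \xi_{n,k}\Big)\;\le\;\mathrm{Lin}\big(\{\xi_{n,k}\}\big),$$ where $K(\eta,\eta')=\sup_{x\in\mathbb{R}}\big|\mathbb{P}[\eta\le x]-\mathbb{P}[\eta'\le x]\big|$ is the Kolmogorov distance and $$\mathrm{Lin}\big(\{\xi_{n,k}\}\big)=\sup_{\varepsilon>0}\,\limsup_{n\to\infty}\,\sum_{k=1}^n \mathbb{E}\big[\xi_{n,k}^2;\,|\xi_{n,k}|\ge\varepsilon\big]$$ is the Lindeberg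 index. -/

import Mathlib

open MeasureTheory ProbabilityTheory Filter Topology

noncomputable section

/-- A standard triangular array: for every `n ≥ 1`, the `n` variables of the `n`-th row
(indexed by `Fin n`) are real square integrable random variables on a probability space, they are
independent and centred, and their variances sum to `1`.  The rows may live on different
probability spaces; the (empty) row `n = 0` is unconstrained. -/
structure IsStandardTriangularArray {Ω : ℕ → Type*} [∀ n, MeasurableSpace (Ω n)]
    (P : ∀ n, Measure (Ω n)) (X : ∀ n, Fin n → Ω n → ℝ) : Prop where
  measurable : ∀ n, 1 ≤ n → ∀ k, Measurable (X n k)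
  memLp_two : ∀ n, 1 ≤ n → ∀ k, MemLp (X n k) 2 (P n)
  indep : ∀ n, 1 ≤ n → iIndepFun (X n) (P n)
  mean_zero : ∀ n, 1 ≤ n → ∀ k, ∫ ω, X n k ω ∂(P n) = 0
  sum_variance : ∀ n, 1 ≤ n → ∑ k, ∫ ω, X n k ω ^ 2 ∂(P n) = 1

/-- Feller's negligibility condition: the maximum over `k` of `E[X_{n,k}²]` tends to `0`.
(The supremum is over the finite set `Fin n`, hence a maximum when `n ≥ 1`.) -/
def FellerNegligible {Ω : ℕ → Type*} [∀ n, MeasurableSpace (Ω n)]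
    (P : ∀ n, Measure (Ω n)) (X : ∀ n, Fin n → Ω n → ℝ) : Prop :=
  Tendsto (fun n ↦ ⨆ k, ∫ ω, X n k ω ^ 2 ∂(P n)) atTop (𝓝 0)

/-- The Kolmogorov distance `sup_x |P[Y ≤ x] - P'[Y' ≤ x]|` between two real random variables,
possibly on different probability spaces.  For probability measures the supremum is over a
nonempty set of reals contained in `[0, 1]`. -/
def kolmogorovDist {Ω Ω' : Type*} [MeasurableSpace Ω] [MeasurableSpace Ω']
    (P : Measure Ω) (Y : Ω → ℝ) (P' : Measure Ω') (Y' : Ω' → ℝ) : ℝ :=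
  ⨆ x : ℝ, |P.real {ω | Y ω ≤ x} - P'.real {ω | Y' ω ≤ x}|

/-- The Lindeberg index `sup_{ε > 0} limsup_n ∑_k E[X_{n,k}² ; |X_{n,k}| ≥ ε]`.
For a standard triangular array the sums lie in `[0, 1]` for every `n ≥ 1`, so that the upper limit
and the supremum are those of bounded families of reals. -/
def lindebergIndex {Ω : ℕ → Type*} [∀ n, MeasurableSpace (Ω n)]
    (P : ∀ n, Measure (Ω n)) (X : ∀ n, Fin n → Ω n → ℝ) : ℝ :=
  ⨆ ε : Set.Ioi (0 : ℝ), limsup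
    (fun n ↦ ∑ k, ∫ ω in {ω | (ε : ℝ) ≤ |X n k ω|}, X n k ω ^ 2 ∂(P n)) atTop

end

/-! The proof is Stein's method with sharp constants. Write Φ, φ for the normal distribution
function and density, and R = Φ/φ. Smooth the indicator of a half-line by a density m ≤ M supported
on an interval of length d. Stein's equation f'(w) - w f(w) = h(w) - E h(ξ) for the smoothed
indicator h has the explicit solution f(w) = R(w) ∫_{t>w} m(1-Φ) + R(-w) ∫_{t<w} mΦ. Since R' and
R'' are nonnegative, two Wronskian-type identities for R(x) and R(-x) show that f' is M-Lipschitz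
(`abs_steinSolDeriv_sub_le`) and has oscillation at most 1 (`abs_steinSolDeriv_sub_le_one`).

For W = ∑ X_k, expand X_k f(W) around V = W - X_k, which is independent of X_k. Where |X_k| < ε, the
Lipschitz bound gives an error of at most Mε X_k²; elsewhere, the oscillation bound gives at most
X_k². This second bound is why the Lindeberg sum appears with constant exactly 1. Replacing f'(V) by
f'(W) costs M times the largest standard deviation, which Feller's condition sends to 0
(`abs_integral_stein_sum_le`). Undoing the smoothing costs d. With M = 2/d, let n tend to infinity
with ε much smaller than d, and d small. -/

/-! ### The standard normal distribution function and its Mills-type ratio -/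

/-- The density of the standard normal distribution. -/
noncomputable def stdPdf (x : ℝ) : ℝ := gaussianPDFReal 0 1 x

/-- The distribution function of the standard normal distribution. -/
noncomputable def stdCdf (x : ℝ) : ℝ := cdf (gaussianReal 0 1) x

lemma stdPdf_eq (x : ℝ) : stdPdf x = (√(2 * Real.pi))⁻¹ * Real.exp (-x ^ 2 / 2) := by
  simp [stdPdf, gaussianPDFReal]

lemma stdPdf_pos (x : ℝ) : 0 < stdPdf x := gaussianPDFReal_pos _ _ _ one_ne_zero

lemma stdPdf_neg (x : ℝ) : stdPdf (-x) = stdPdf x := by simp [stdPdf_eq]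

lemma stdPdf_le_one (x : ℝ) : stdPdf x ≤ 1 := by
  rw [stdPdf_eq]
  refine mul_le_one₀ (inv_le_one_of_one_le₀ ?_) (Real.exp_nonneg _) (Real.exp_le_one_iff.2 ?_)
  · rw [Real.one_le_sqrt]
    linarith [Real.pi_gt_three]
  · nlinarith [sq_nonneg x]

lemma hasDerivAt_stdPdf (x : ℝ) : HasDerivAt stdPdf (-x * stdPdf x) x := by
  have h : HasDerivAt (fun x : ℝ ↦ -x ^ 2 / 2) (-x) x := by
    have := ((hasDerivAt_id x).pow 2).neg.div_const 2
    refine (this.congr_deriv ?_)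
    simp
    ring
  have h2 := (h.exp).const_mul (√(2 * Real.pi))⁻¹
  rw [show stdPdf = fun x ↦ (√(2 * Real.pi))⁻¹ * Real.exp (-x ^ 2 / 2) from funext stdPdf_eq]
  exact h2.congr_deriv (by ring)

lemma continuous_stdPdf : Continuous stdPdf :=
  continuous_iff_continuousAt.2 fun x ↦ (hasDerivAt_stdPdf x).continuousAt

lemma stdCdf_eq_integral (x : ℝ) : stdCdf x = ∫ t in Set.Iic x, stdPdf t := by
  rw [stdCdf, cdf_eq_real, measureReal_def, gaussianReal_apply_eq_integral _ one_ne_zero,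
    ENNReal.toReal_ofReal (integral_nonneg fun t ↦ gaussianPDFReal_nonneg _ _ _)]
  rfl

lemma stdCdf_nonneg (x : ℝ) : 0 ≤ stdCdf x := cdf_nonneg _ _

lemma stdCdf_le_one (x : ℝ) : stdCdf x ≤ 1 := cdf_le_one _ _

lemma monotone_stdCdf : Monotone stdCdf := monotone_cdf _

lemma hasDerivAt_stdCdf (x : ℝ) : HasDerivAt stdCdf (stdPdf x) x := by
  have hi : Integrable stdPdf := integrable_gaussianPDFReal 0 1
  have h : stdCdf = fun x ↦ stdCdf 0 + ∫ t in (0 : ℝ)..x, stdPdf t := by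
    ext x
    rw [← intervalIntegral.integral_Iic_sub_Iic hi.integrableOn hi.integrableOn,
      stdCdf_eq_integral, stdCdf_eq_integral]
    ring
  rw [h]
  exact (continuous_stdPdf.integral_hasStrictDerivAt 0 x).hasDerivAt.const_add _

lemma continuous_stdCdf : Continuous stdCdf :=
  continuous_iff_continuousAt.2 fun x ↦ (hasDerivAt_stdCdf x).continuousAt

lemma stdCdf_add_le (x : ℝ) {d : ℝ} (hd : 0 ≤ d) : stdCdf (x + d) ≤ stdCdf x + d := by
  have h := Convex.norm_image_sub_le_of_norm_hasDerivWithin_le (C := 1) (s := Set.univ)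
    (x := x) (y := x + d) (fun y _ ↦ (hasDerivAt_stdCdf y).hasDerivWithinAt)
    (fun y _ ↦ by
      rw [Real.norm_of_nonneg (stdPdf_pos y).le]
      exact stdPdf_le_one y) convex_univ trivial trivial
  rw [Real.norm_eq_abs, Real.norm_eq_abs, add_sub_cancel_left, abs_of_nonneg hd] at h
  linarith [le_abs_self (stdCdf (x + d) - stdCdf x)]

lemma stdCdf_neg (x : ℝ) : stdCdf (-x) = 1 - stdCdf x := by
  have hd : ∀ y, HasDerivAt (fun y ↦ stdCdf y + stdCdf (-y)) 0 y := fun y ↦ by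
    have h := (hasDerivAt_stdCdf y).add ((hasDerivAt_stdCdf (-y)).comp y (hasDerivAt_neg y))
    exact h.congr_deriv (by rw [stdPdf_neg]; ring)
  have hc : ∀ y z, stdCdf y + stdCdf (-y) = stdCdf z + stdCdf (-z) :=
    is_const_of_deriv_eq_zero (fun y ↦ (hd y).differentiableAt) fun y ↦ (hd y).deriv
  have ht : Tendsto (fun y ↦ stdCdf y + stdCdf (-y)) atTop (𝓝 (1 + 0)) :=
    (tendsto_cdf_atTop _).add ((tendsto_cdf_atBot _).comp tendsto_neg_atTop_atBot)
  have ht' : Tendsto (fun y ↦ stdCdf y + stdCdf (-y)) atTop (𝓝 (stdCdf x + stdCdf (-x))) := by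
    simp_rw [hc _ x]
    exact tendsto_const_nhds
  linarith [tendsto_nhds_unique ht ht']

/-- Chernoff's bound with parameter x itself: exp(-x²) times the moment generating function
exp(x²/2). -/
lemma stdCdf_le_exp {x : ℝ} (hx : x ≤ 0) : stdCdf x ≤ Real.exp (-x ^ 2 / 2) := by
  have h := measure_le_le_exp_mul_mgf (μ := gaussianReal 0 1) (X := id) x hx
    (integrable_exp_mul_gaussianReal x)
  rw [mgf_id_gaussianReal, ← Real.exp_add] at h
  rw [stdCdf, cdf_eq_real]
  refine h.trans_eq (congrArg _ ?_)
  simp only [NNReal.coe_one]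
  ring

lemma tendsto_sq_div_two_atBot : Tendsto (fun x : ℝ ↦ x ^ 2 / 2) atBot atTop := by
  refine Tendsto.atTop_div_const two_pos ?_
  simpa [Function.comp_def] using
    (tendsto_pow_atTop (α := ℝ) two_ne_zero).comp tendsto_neg_atBot_atTop

lemma tendsto_sq_mul_exp_atBot :
    Tendsto (fun x : ℝ ↦ 2 * ((x ^ 2 / 2) ^ 1 * Real.exp (-(x ^ 2 / 2)))) atBot (𝓝 0) := by
  have h := ((Real.tendsto_pow_mul_exp_neg_atTop_nhds_zero 1).comp
    tendsto_sq_div_two_atBot).const_mul 2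
  rwa [mul_zero] at h

lemma tendsto_sq_mul_stdCdf_atBot : Tendsto (fun x ↦ x ^ 2 * stdCdf x) atBot (𝓝 0) := by
  have h := tendsto_sq_mul_exp_atBot
  refine squeeze_zero' (.of_forall fun x ↦ mul_nonneg (sq_nonneg x) (stdCdf_nonneg x)) ?_ h
  filter_upwards [eventually_le_atBot 0] with x hx
  have := mul_le_mul_of_nonneg_left (stdCdf_le_exp hx) (sq_nonneg x)
  rw [neg_div] at this
  linarith

lemma nonneg_of_hasDerivAt_nonneg_of_tendsto {f f' : ℝ → ℝ} (hf : ∀ x, HasDerivAt f (f' x) x)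
    (hf' : ∀ x, 0 ≤ f' x) (hl : Tendsto f atBot (𝓝 0)) (x : ℝ) : 0 ≤ f x :=
  (monotone_of_hasDerivAt_nonneg hf hf').le_of_tendsto hl x

lemma tendsto_mul_stdCdf_atBot : Tendsto (fun x ↦ x * stdCdf x) atBot (𝓝 0) := by
  rw [tendsto_zero_iff_abs_tendsto_zero]
  refine squeeze_zero' (.of_forall fun x ↦ abs_nonneg _) ?_ tendsto_sq_mul_stdCdf_atBot
  filter_upwards [eventually_le_atBot (-1)] with x hx
  simp only [Function.comp_apply]
  rw [abs_mul, abs_of_nonneg (stdCdf_nonneg x), abs_of_nonpos (by linarith)]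
  exact mul_le_mul_of_nonneg_right (by nlinarith) (stdCdf_nonneg x)

lemma tendsto_stdPdf_atBot : Tendsto stdPdf atBot (𝓝 0) := by
  rw [funext stdPdf_eq]
  have h : Tendsto (fun x : ℝ ↦ (√(2 * Real.pi))⁻¹ * Real.exp (-(x ^ 2 / 2))) atBot
      (𝓝 ((√(2 * Real.pi))⁻¹ * 0)) := by
    refine (Real.tendsto_exp_neg_atTop_nhds_zero.comp ?_).const_mul _
    exact tendsto_sq_div_two_atBot
  simpa only [neg_div, mul_zero] using h

lemma tendsto_mul_stdPdf_atBot : Tendsto (fun x ↦ x * stdPdf x) atBot (𝓝 0) := by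
  rw [tendsto_zero_iff_abs_tendsto_zero]
  have h := tendsto_sq_mul_exp_atBot
  have h2 := h.const_mul (√(2 * Real.pi))⁻¹
  rw [mul_zero] at h2
  refine squeeze_zero' (.of_forall fun x ↦ abs_nonneg _) ?_ h2
  filter_upwards [eventually_le_atBot (-1)] with x hx
  simp only [Function.comp_apply]
  rw [abs_mul, abs_of_nonneg (stdPdf_pos x).le, abs_of_nonpos (by linarith)]
  refine (mul_le_mul_of_nonneg_right (show -x ≤ x ^ 2 by nlinarith) (stdPdf_pos x).le).trans_eq ?_
  rw [stdPdf_eq, neg_div]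
  ring

/-- The expression has derivative Φ ≥ 0 and vanishes at -∞. Divided by φ it is R'. -/
lemma mul_stdCdf_add_stdPdf_nonneg (x : ℝ) : 0 ≤ x * stdCdf x + stdPdf x := by
  refine nonneg_of_hasDerivAt_nonneg_of_tendsto (f := fun x ↦ x * stdCdf x + stdPdf x)
    (fun x ↦ ?_) stdCdf_nonneg ?_ x
  · exact (((hasDerivAt_id x).mul (hasDerivAt_stdCdf x)).add (hasDerivAt_stdPdf x)).congr_deriv
      (by simp)
  · simpa using tendsto_mul_stdCdf_atBot.add tendsto_stdPdf_atBot

/-- The derivative is twice the expression of the previous lemma, and the limit at -∞ is 0. Divided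
by φ this is R''. -/
lemma sq_mul_stdCdf_add_mul_stdPdf_nonneg (x : ℝ) :
    0 ≤ (1 + x ^ 2) * stdCdf x + x * stdPdf x := by
  refine nonneg_of_hasDerivAt_nonneg_of_tendsto
    (f := fun x ↦ (1 + x ^ 2) * stdCdf x + x * stdPdf x)
    (f' := fun x ↦ 2 * (x * stdCdf x + stdPdf x))
    (fun x ↦ ?_) (fun x ↦ mul_nonneg zero_le_two (mul_stdCdf_add_stdPdf_nonneg x)) ?_ x
  · have h1 := ((hasDerivAt_id x).pow 2).const_add 1
    have h2 := (h1.mul (hasDerivAt_stdCdf x)).add ((hasDerivAt_id x).mul (hasDerivAt_stdPdf x))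
    refine h2.congr_deriv ?_
    simp
    ring
  · have h := ((tendsto_cdf_atBot (gaussianReal 0 1)).add tendsto_sq_mul_stdCdf_atBot).add
      tendsto_mul_stdPdf_atBot
    simp only [add_zero] at h
    refine h.congr fun x ↦ ?_
    simp only [stdCdf]
    ring

/-- The ratio of the standard normal distribution function to its density. -/
noncomputable def cdfRatio (x : ℝ) : ℝ := stdCdf x / stdPdf x

/-- The first derivative of `cdfRatio`. -/
noncomputable def cdfRatio₁ (x : ℝ) : ℝ := 1 + x * cdfRatio x

/-- The second derivative of `cdfRatio`. -/
noncomputable def cdfRatio₂ (x : ℝ) : ℝ := cdfRatio x + x * cdfRatio₁ x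

lemma cdfRatio_mul_stdPdf (x : ℝ) : cdfRatio x * stdPdf x = stdCdf x :=
  div_mul_cancel₀ _ (stdPdf_pos x).ne'

lemma cdfRatio_neg_mul_stdPdf (x : ℝ) : cdfRatio (-x) * stdPdf x = 1 - stdCdf x := by
  rw [← stdPdf_neg, cdfRatio_mul_stdPdf, stdCdf_neg]

lemma hasDerivAt_cdfRatio (x : ℝ) : HasDerivAt cdfRatio (cdfRatio₁ x) x := by
  have hp := (stdPdf_pos x).ne'
  refine ((hasDerivAt_stdCdf x).div (hasDerivAt_stdPdf x) hp).congr_deriv ?_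
  rw [cdfRatio₁, cdfRatio]
  field_simp
  ring

lemma hasDerivAt_cdfRatio₁ (x : ℝ) : HasDerivAt cdfRatio₁ (cdfRatio₂ x) x := by
  refine (((hasDerivAt_id x).mul (hasDerivAt_cdfRatio x)).const_add 1).congr_deriv ?_
  simp [cdfRatio₂]

lemma cdfRatio₁_nonneg (x : ℝ) : 0 ≤ cdfRatio₁ x := by
  have h : cdfRatio₁ x = (x * stdCdf x + stdPdf x) / stdPdf x := by
    have hp := (stdPdf_pos x).ne'
    rw [cdfRatio₁, cdfRatio]
    field_simp
    ring
  rw [h]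
  exact div_nonneg (mul_stdCdf_add_stdPdf_nonneg x) (stdPdf_pos x).le

lemma cdfRatio₂_nonneg (x : ℝ) : 0 ≤ cdfRatio₂ x := by
  have h : cdfRatio₂ x = ((1 + x ^ 2) * stdCdf x + x * stdPdf x) / stdPdf x := by
    have hp := (stdPdf_pos x).ne'
    rw [cdfRatio₂, cdfRatio₁, cdfRatio]
    field_simp
    ring
  rw [h]
  exact div_nonneg (sq_mul_stdCdf_add_mul_stdPdf_nonneg x) (stdPdf_pos x).le

lemma monotone_cdfRatio₁ : Monotone cdfRatio₁ :=
  monotone_of_hasDerivAt_nonneg hasDerivAt_cdfRatio₁ cdfRatio₂_nonneg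

lemma continuous_cdfRatio₁ : Continuous cdfRatio₁ :=
  continuous_iff_continuousAt.2 fun x ↦ (hasDerivAt_cdfRatio₁ x).continuousAt

/-- The terms in x cancel because R(x)(1-Φ(x)) and R(-x)Φ(x) both equal R(x)R(-x)φ(x). This identity
makes the oscillation of f' at most exactly 1. -/
lemma cdfRatio₁_mul_add_cdfRatio₁_neg_mul (x : ℝ) :
    cdfRatio₁ x * (1 - stdCdf x) + cdfRatio₁ (-x) * stdCdf x = 1 := by
  rw [cdfRatio₁, cdfRatio₁, ← cdfRatio_neg_mul_stdPdf]
  linear_combination (1 - x * cdfRatio (-x)) * (-cdfRatio_mul_stdPdf x) + cdfRatio_mul_stdPdf x +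
    cdfRatio_neg_mul_stdPdf x

/-- The Wronskian of R'(x) and R'(-x) is, up to sign, 1/φ. This gives the Lipschitz constant of f'
without any loss. -/
lemma stdPdf_mul_cdfRatio₂_add (x : ℝ) :
    cdfRatio₂ x * (stdPdf x * cdfRatio₁ (-x)) + cdfRatio₂ (-x) * (stdPdf x * cdfRatio₁ x) = 1 := by
  rw [cdfRatio₂, cdfRatio₂, cdfRatio₁, cdfRatio₁]
  linear_combination cdfRatio_mul_stdPdf x + cdfRatio_neg_mul_stdPdf x

/-- Indeed φR' = xΦ + φ, the antiderivative of Φ vanishing at -∞; it serves to bound `steinLower`.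
-/
lemma hasDerivAt_stdPdf_mul_cdfRatio₁ (x : ℝ) :
    HasDerivAt (fun x ↦ stdPdf x * cdfRatio₁ x) (stdCdf x) x := by
  refine ((hasDerivAt_stdPdf x).mul (hasDerivAt_cdfRatio₁ x)).congr_deriv ?_
  rw [cdfRatio₂, ← cdfRatio_mul_stdPdf]
  ring

lemma hasDerivAt_stdPdf_mul_cdfRatio₁_neg (x : ℝ) :
    HasDerivAt (fun x ↦ stdPdf x * cdfRatio₁ (-x)) (-(1 - stdCdf x)) x := by
  have h := (hasDerivAt_stdPdf_mul_cdfRatio₁ (-x)).comp x (hasDerivAt_neg x)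
  simp only [Function.comp_def, stdPdf_neg] at h
  exact h.congr_deriv (by rw [stdCdf_neg]; ring)

/-! ### Solutions of Stein's equation for smoothed indicators -/

/-- `m` is a continuous probability density, bounded by `M` and supported in `[a, b]`. -/
structure IsBumpDensity (m : ℝ → ℝ) (a b M : ℝ) : Prop where
  le : a ≤ b
  continuous : Continuous m
  nonneg : ∀ t, 0 ≤ m t
  le_bound : ∀ t, m t ≤ M
  eq_zero_of_le : ∀ t, t ≤ a → m t = 0
  eq_zero_of_ge : ∀ t, b ≤ t → m t = 0
  integral_eq_one : ∫ t in a..b, m t = 1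

/-- The smoothed indicator of a left half-line attached to the density `m`. -/
noncomputable def smoothStep (m : ℝ → ℝ) (b w : ℝ) : ℝ := ∫ t in w..b, m t

/-- The average of the standard normal distribution function with respect to `m`. -/
noncomputable def smoothCdf (m : ℝ → ℝ) (a b : ℝ) : ℝ := ∫ t in a..b, m t * stdCdf t

/-- The coefficient of `cdfRatio w` in the solution of Stein's equation. -/
noncomputable def steinUpper (m : ℝ → ℝ) (b w : ℝ) : ℝ := ∫ t in w..b, m t * (1 - stdCdf t)

/-- The coefficient of `cdfRatio (-w)` in the solution of Stein's equation. -/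
noncomputable def steinLower (m : ℝ → ℝ) (a w : ℝ) : ℝ := ∫ t in a..w, m t * stdCdf t

/-- The solution of Stein's equation for `smoothStep m b`. -/
noncomputable def steinSol (m : ℝ → ℝ) (a b w : ℝ) : ℝ :=
  cdfRatio w * steinUpper m b w + cdfRatio (-w) * steinLower m a w

/-- The derivative of `steinSol`. -/
noncomputable def steinSolDeriv (m : ℝ → ℝ) (a b w : ℝ) : ℝ :=
  cdfRatio₁ w * steinUpper m b w - cdfRatio₁ (-w) * steinLower m a w

/-! ### Integrals of compactly supported functions over half-lines -/

section TailIntegrals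

variable {q : ℝ → ℝ} {a b : ℝ}

lemma integral_eq_zero_of_le (ha : ∀ t, t ≤ a → q t = 0) {w : ℝ} (hw : w ≤ a) :
    ∫ t in w..a, q t = 0 := by
  refine intervalIntegral.integral_zero_ae (.of_forall fun t ht ↦ ha t ?_)
  rw [Set.uIoc_of_le hw] at ht
  exact ht.2

lemma integral_eq_zero_of_ge (hb : ∀ t, b ≤ t → q t = 0) {w : ℝ} (hw : b ≤ w) :
    ∫ t in b..w, q t = 0 := by
  refine intervalIntegral.integral_zero_ae (.of_forall fun t ht ↦ hb t ?_)
  rw [Set.uIoc_of_le hw] at ht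
  exact ht.1.le

lemma integral_upper_nonneg (hq0 : ∀ t, 0 ≤ q t) (hb : ∀ t, b ≤ t → q t = 0) (w : ℝ) :
    0 ≤ ∫ t in w..b, q t := by
  rcases le_total w b with h | h
  · exact intervalIntegral.integral_nonneg h fun t _ ↦ hq0 t
  · rw [intervalIntegral.integral_symm, integral_eq_zero_of_ge hb h, neg_zero]

lemma integral_lower_nonneg (hq0 : ∀ t, 0 ≤ q t) (ha : ∀ t, t ≤ a → q t = 0) (w : ℝ) :
    0 ≤ ∫ t in a..w, q t := by
  rcases le_total a w with h | h
  · exact intervalIntegral.integral_nonneg h fun t _ ↦ hq0 t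
  · rw [intervalIntegral.integral_symm, integral_eq_zero_of_le ha h, neg_zero]

lemma integral_lower_add_upper (hq : Continuous q) (w : ℝ) :
    ∫ t in a..b, q t = (∫ t in a..w, q t) + ∫ t in w..b, q t :=
  (intervalIntegral.integral_add_adjacent_intervals (hq.intervalIntegrable _ _)
    (hq.intervalIntegrable _ _)).symm

/-- On the part above w, monotonicity gives g w ≤ g t; the part below w only adds nonnegative mass.
Since q vanishes outside [a, b], the oriented integrals behave as half-line integrals even for w
outside that interval. -/
lemma mul_integral_upper_le {g : ℝ → ℝ} (hq : Continuous q) (hq0 : ∀ t, 0 ≤ q t)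
    (ha : ∀ t, t ≤ a → q t = 0) (hb : ∀ t, b ≤ t → q t = 0) (hg : Continuous g)
    (hg0 : ∀ t, 0 ≤ g t) (hm : Monotone g) (w : ℝ) :
    g w * ∫ t in w..b, q t ≤ ∫ t in a..b, g t * q t := by
  have h1 : g w * ∫ t in w..b, q t ≤ ∫ t in w..b, g t * q t := by
    rw [← intervalIntegral.integral_const_mul]
    rcases le_total w b with h | h
    · refine intervalIntegral.integral_mono_on h ((hq.const_mul _).intervalIntegrable _ _)
        ((hg.mul hq).intervalIntegrable _ _) fun t ht ↦ ?_
      exact mul_le_mul_of_nonneg_right (hm ht.1) (hq0 t)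
    · rw [intervalIntegral.integral_symm, intervalIntegral.integral_symm b,
        integral_eq_zero_of_ge (fun t ht ↦ by rw [hb t ht, mul_zero]) h,
        integral_eq_zero_of_ge (fun t ht ↦ by rw [hb t ht, mul_zero]) h]
  rw [integral_lower_add_upper (q := fun t ↦ g t * q t) (hg.mul hq) w]
  have h2 := integral_lower_nonneg (q := fun t ↦ g t * q t) (a := a)
    (fun t ↦ mul_nonneg (hg0 t) (hq0 t)) (fun t ht ↦ by rw [ha t ht, mul_zero]) w
  linarith

lemma mul_integral_lower_le {g : ℝ → ℝ} (hq : Continuous q) (hq0 : ∀ t, 0 ≤ q t)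
    (ha : ∀ t, t ≤ a → q t = 0) (hb : ∀ t, b ≤ t → q t = 0) (hg : Continuous g)
    (hg0 : ∀ t, 0 ≤ g t) (hm : Antitone g) (w : ℝ) :
    g w * ∫ t in a..w, q t ≤ ∫ t in a..b, g t * q t := by
  have h1 : g w * ∫ t in a..w, q t ≤ ∫ t in a..w, g t * q t := by
    rw [← intervalIntegral.integral_const_mul]
    rcases le_total a w with h | h
    · refine intervalIntegral.integral_mono_on h ((hq.const_mul _).intervalIntegrable _ _)
        ((hg.mul hq).intervalIntegrable _ _) fun t ht ↦ ?_
      exact mul_le_mul_of_nonneg_right (hm ht.2) (hq0 t)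
    · rw [intervalIntegral.integral_symm, intervalIntegral.integral_symm w,
        integral_eq_zero_of_le (fun t ht ↦ by rw [ha t ht, mul_zero]) h,
        integral_eq_zero_of_le (fun t ht ↦ by rw [ha t ht, mul_zero]) h]
  rw [integral_lower_add_upper (q := fun t ↦ g t * q t) (hg.mul hq) w]
  have h2 := integral_upper_nonneg (q := fun t ↦ g t * q t) (b := b)
    (fun t ↦ mul_nonneg (hg0 t) (hq0 t)) (fun t ht ↦ by rw [hb t ht, mul_zero]) w
  linarith

end TailIntegrals

namespace IsBumpDensity

variable {m : ℝ → ℝ} {a b M : ℝ} (hm : IsBumpDensity m a b M)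

include hm

lemma bound_nonneg : 0 ≤ M := (hm.nonneg a).trans (hm.le_bound a)

lemma continuous_mul_one_sub : Continuous fun t ↦ m t * (1 - stdCdf t) :=
  hm.continuous.mul (continuous_const.sub continuous_stdCdf)

lemma continuous_mul_stdCdf : Continuous fun t ↦ m t * stdCdf t :=
  hm.continuous.mul continuous_stdCdf

lemma hasDerivAt_steinUpper (w : ℝ) :
    HasDerivAt (steinUpper m b) (-(m w * (1 - stdCdf w))) w := by
  have h := (hm.continuous_mul_one_sub.integral_hasStrictDerivAt b w).hasDerivAt.neg
  refine h.congr_of_eventuallyEq (.of_forall fun x ↦ ?_)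
  rw [steinUpper, intervalIntegral.integral_symm]
  rfl

lemma hasDerivAt_steinLower (w : ℝ) :
    HasDerivAt (steinLower m a) (m w * stdCdf w) w :=
  (hm.continuous_mul_stdCdf.integral_hasStrictDerivAt a w).hasDerivAt

lemma steinUpper_nonneg (w : ℝ) : 0 ≤ steinUpper m b w :=
  integral_upper_nonneg (fun t ↦ mul_nonneg (hm.nonneg t) (sub_nonneg.2 (stdCdf_le_one t)))
    (fun t ht ↦ by rw [hm.eq_zero_of_ge t ht, zero_mul]) w

lemma steinLower_nonneg (w : ℝ) : 0 ≤ steinLower m a w :=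
  integral_lower_nonneg (fun t ↦ mul_nonneg (hm.nonneg t) (stdCdf_nonneg t))
    (fun t ht ↦ by rw [hm.eq_zero_of_le t ht, zero_mul]) w

/-- Bounding m by M leaves M ∫_w^∞ (1-Φ), which is the right-hand side. In derivative form, the
difference is antitone, and it is nonnegative at max w b, where `steinUpper` vanishes. -/
lemma steinUpper_le (w : ℝ) : steinUpper m b w ≤ M * (stdPdf w * cdfRatio₁ (-w)) := by
  have hd : ∀ x, HasDerivAt (fun x ↦ M * (stdPdf x * cdfRatio₁ (-x)) - steinUpper m b x)
      (-((M - m x) * (1 - stdCdf x))) x := fun x ↦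
    (((hasDerivAt_stdPdf_mul_cdfRatio₁_neg x).const_mul M).sub
      (hm.hasDerivAt_steinUpper x)).congr_deriv (by ring)
  have hanti := antitone_of_hasDerivAt_nonpos hd fun x ↦ neg_nonpos.2 <|
    mul_nonneg (sub_nonneg.2 (hm.le_bound x)) (sub_nonneg.2 (stdCdf_le_one x))
  have h := hanti (le_max_left w b)
  have h0 : steinUpper m b (max w b) = 0 := by
    rw [steinUpper, intervalIntegral.integral_symm, integral_eq_zero_of_ge
      (fun t ht ↦ by rw [hm.eq_zero_of_ge t ht, zero_mul]) (le_max_right w b), neg_zero]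
  have hp := mul_nonneg hm.bound_nonneg
    (mul_nonneg (stdPdf_pos (max w b)).le (cdfRatio₁_nonneg (-max w b)))
  simp only [h0] at h
  linarith

lemma steinLower_le (w : ℝ) : steinLower m a w ≤ M * (stdPdf w * cdfRatio₁ w) := by
  have hd : ∀ x, HasDerivAt (fun x ↦ M * (stdPdf x * cdfRatio₁ x) - steinLower m a x)
      ((M - m x) * stdCdf x) x := fun x ↦
    (((hasDerivAt_stdPdf_mul_cdfRatio₁ x).const_mul M).sub
      (hm.hasDerivAt_steinLower x)).congr_deriv (by ring)
  have hmono := monotone_of_hasDerivAt_nonneg hd fun x ↦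
    mul_nonneg (sub_nonneg.2 (hm.le_bound x)) (stdCdf_nonneg x)
  have h := hmono (min_le_left w a)
  have h0 : steinLower m a (min w a) = 0 := by
    rw [steinLower, intervalIntegral.integral_symm, integral_eq_zero_of_le
      (fun t ht ↦ by rw [hm.eq_zero_of_le t ht, zero_mul]) (min_le_right w a), neg_zero]
  have hp := mul_nonneg hm.bound_nonneg
    (mul_nonneg (stdPdf_pos (min w a)).le (cdfRatio₁_nonneg (min w a)))
  simp only [h0] at h
  linarith

lemma hasDerivAt_steinSol (w : ℝ) :
    HasDerivAt (steinSol m a b) (steinSolDeriv m a b w) w := by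
  have h1 := (hasDerivAt_cdfRatio w).mul (hm.hasDerivAt_steinUpper w)
  have h2 := ((hasDerivAt_cdfRatio (-w)).comp w (hasDerivAt_neg w)).mul
    (hm.hasDerivAt_steinLower w)
  refine (h1.add h2).congr_deriv ?_
  simp only [Function.comp_apply]
  rw [steinSolDeriv, ← cdfRatio_neg_mul_stdPdf, ← cdfRatio_mul_stdPdf]
  ring

lemma hasDerivAt_steinSolDeriv (w : ℝ) :
    HasDerivAt (steinSolDeriv m a b)
      (cdfRatio₂ w * steinUpper m b w + cdfRatio₂ (-w) * steinLower m a w - m w) w := by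
  have h1 := (hasDerivAt_cdfRatio₁ w).mul (hm.hasDerivAt_steinUpper w)
  have h2 := ((hasDerivAt_cdfRatio₁ (-w)).comp w (hasDerivAt_neg w)).mul
    (hm.hasDerivAt_steinLower w)
  refine (h1.sub h2).congr_deriv ?_
  simp only [Function.comp_apply]
  linear_combination (-m w) * cdfRatio₁_mul_add_cdfRatio₁_neg_mul w

/-- The derivative of f' is a sum of two nonnegative terms minus m. By the Wronskian identity the
two terms add up to at most M, and 0 ≤ m ≤ M, so the difference lies in [-M, M]. -/
lemma abs_steinSolDeriv_sub_le (x y : ℝ) :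
    |steinSolDeriv m a b y - steinSolDeriv m a b x| ≤ M * |y - x| := by
  refine Convex.norm_image_sub_le_of_norm_hasDerivWithin_le (s := Set.univ)
    (fun w _ ↦ (hm.hasDerivAt_steinSolDeriv w).hasDerivWithinAt) (fun w _ ↦ ?_) convex_univ
    trivial trivial
  have h1 := mul_nonneg (cdfRatio₂_nonneg w) (hm.steinUpper_nonneg w)
  have h2 := mul_nonneg (cdfRatio₂_nonneg (-w)) (hm.steinLower_nonneg w)
  have h3 := mul_le_mul_of_nonneg_left (hm.steinUpper_le w) (cdfRatio₂_nonneg w)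
  have h4 := mul_le_mul_of_nonneg_left (hm.steinLower_le w) (cdfRatio₂_nonneg (-w))
  have h5 : cdfRatio₂ w * (M * (stdPdf w * cdfRatio₁ (-w))) +
      cdfRatio₂ (-w) * (M * (stdPdf w * cdfRatio₁ w)) = M := by
    linear_combination M * stdPdf_mul_cdfRatio₂_add w
  rw [Real.norm_eq_abs, abs_le]
  constructor <;> linarith [hm.nonneg w, hm.le_bound w]

/-- After dropping the negative terms, R'(y) times the upper integral at y and R'(-x) times the
lower integral at x remain. As R' is increasing, it can be moved inside each integral and both
ranges enlarged to [a, b]; the integrands then add up to m, of total mass 1. -/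
lemma steinSolDeriv_sub_le_one (x y : ℝ) :
    steinSolDeriv m a b y - steinSolDeriv m a b x ≤ 1 := by
  have hU := mul_integral_upper_le hm.continuous_mul_one_sub
    (fun t ↦ mul_nonneg (hm.nonneg t) (sub_nonneg.2 (stdCdf_le_one t)))
    (fun t ht ↦ by rw [hm.eq_zero_of_le t ht, zero_mul])
    (fun t ht ↦ by rw [hm.eq_zero_of_ge t ht, zero_mul]) continuous_cdfRatio₁ cdfRatio₁_nonneg
    monotone_cdfRatio₁ y
  have hL := mul_integral_lower_le (g := fun t ↦ cdfRatio₁ (-t)) hm.continuous_mul_stdCdf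
    (fun t ↦ mul_nonneg (hm.nonneg t) (stdCdf_nonneg t))
    (fun t ht ↦ by rw [hm.eq_zero_of_le t ht, zero_mul])
    (fun t ht ↦ by rw [hm.eq_zero_of_ge t ht, zero_mul]) (continuous_cdfRatio₁.comp continuous_neg)
    (fun t ↦ cdfRatio₁_nonneg _) (fun s t hst ↦ monotone_cdfRatio₁ (neg_le_neg hst)) x
  have hsum : (∫ t in a..b, cdfRatio₁ t * (m t * (1 - stdCdf t))) +
      ∫ t in a..b, cdfRatio₁ (-t) * (m t * stdCdf t) = 1 := by
    have hi₁ : Continuous fun t ↦ cdfRatio₁ t * (m t * (1 - stdCdf t)) :=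
      continuous_cdfRatio₁.mul hm.continuous_mul_one_sub
    have hi₂ : Continuous fun t ↦ cdfRatio₁ (-t) * (m t * stdCdf t) :=
      (continuous_cdfRatio₁.comp continuous_neg).mul hm.continuous_mul_stdCdf
    rw [← intervalIntegral.integral_add (hi₁.intervalIntegrable _ _)
      (hi₂.intervalIntegrable _ _)]
    refine Eq.trans ?_ hm.integral_eq_one
    refine intervalIntegral.integral_congr fun t _ ↦ ?_
    linear_combination m t * cdfRatio₁_mul_add_cdfRatio₁_neg_mul t
  have hU' : cdfRatio₁ y * steinUpper m b y ≤ _ := hU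
  have hL' : cdfRatio₁ (-x) * steinLower m a x ≤ _ := hL
  have h1 := mul_nonneg (cdfRatio₁_nonneg (-y)) (hm.steinLower_nonneg y)
  have h2 := mul_nonneg (cdfRatio₁_nonneg x) (hm.steinUpper_nonneg x)
  rw [steinSolDeriv, steinSolDeriv]
  linarith

lemma abs_steinSolDeriv_sub_le_one (x y : ℝ) :
    |steinSolDeriv m a b y - steinSolDeriv m a b x| ≤ 1 :=
  abs_le.2 ⟨by linarith [hm.steinSolDeriv_sub_le_one y x], hm.steinSolDeriv_sub_le_one x y⟩

lemma stein_equation (w : ℝ) :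
    steinSolDeriv m a b w - w * steinSol m a b w = smoothStep m b w - smoothCdf m a b := by
  have h1 : steinSolDeriv m a b w - w * steinSol m a b w =
      steinUpper m b w - steinLower m a w := by
    rw [steinSolDeriv, steinSol, cdfRatio₁, cdfRatio₁]
    ring
  have h2 : steinUpper m b w = smoothStep m b w - ∫ t in w..b, m t * stdCdf t := by
    rw [smoothStep, ← intervalIntegral.integral_sub (hm.continuous.intervalIntegrable _ _)
      (hm.continuous_mul_stdCdf.intervalIntegrable _ _)]
    exact intervalIntegral.integral_congr fun t _ ↦ by ring
  have h3 := integral_lower_add_upper (a := a) (b := b) hm.continuous_mul_stdCdf w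
  rw [h1, h2, smoothCdf, h3, steinLower]
  ring

lemma smoothStep_nonneg (w : ℝ) : 0 ≤ smoothStep m b w :=
  integral_upper_nonneg hm.nonneg hm.eq_zero_of_ge w

lemma smoothStep_le_one (w : ℝ) : smoothStep m b w ≤ 1 := by
  have h := integral_lower_add_upper (a := a) (b := b) hm.continuous w
  have h2 := integral_lower_nonneg hm.nonneg hm.eq_zero_of_le w
  rw [hm.integral_eq_one] at h
  rw [smoothStep]
  linarith

lemma smoothStep_eq_one {w : ℝ} (hw : w ≤ a) : smoothStep m b w = 1 := by
  rw [smoothStep, ← hm.integral_eq_one, ← intervalIntegral.integral_add_adjacent_intervals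
    (hm.continuous.intervalIntegrable w a) (hm.continuous.intervalIntegrable a b),
    integral_eq_zero_of_le hm.eq_zero_of_le hw, zero_add]

lemma smoothStep_eq_zero {w : ℝ} (hw : b ≤ w) : smoothStep m b w = 0 := by
  rw [smoothStep, intervalIntegral.integral_symm, integral_eq_zero_of_ge hm.eq_zero_of_ge hw,
    neg_zero]

lemma smoothCdf_le : smoothCdf m a b ≤ stdCdf b := by
  have h : smoothCdf m a b ≤ ∫ t in a..b, m t * stdCdf b :=
    intervalIntegral.integral_mono_on hm.le (hm.continuous_mul_stdCdf.intervalIntegrable _ _)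
      ((hm.continuous.mul_const _).intervalIntegrable _ _) fun t ht ↦
        mul_le_mul_of_nonneg_left (monotone_stdCdf ht.2) (hm.nonneg t)
  rwa [intervalIntegral.integral_mul_const, hm.integral_eq_one, one_mul] at h

lemma le_smoothCdf : stdCdf a ≤ smoothCdf m a b := by
  have h : ∫ t in a..b, m t * stdCdf a ≤ smoothCdf m a b :=
    intervalIntegral.integral_mono_on hm.le ((hm.continuous.mul_const _).intervalIntegrable _ _)
      (hm.continuous_mul_stdCdf.intervalIntegrable _ _) fun t ht ↦
        mul_le_mul_of_nonneg_left (monotone_stdCdf ht.1) (hm.nonneg t)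
  rwa [intervalIntegral.integral_mul_const, hm.integral_eq_one, one_mul] at h

end IsBumpDensity

lemma exists_isBumpDensity (a : ℝ) {d : ℝ} (hd : 0 < d) :
    ∃ m, IsBumpDensity m a (a + d) (2 / d) := by
  -- A parabola vanishing at both endpoints; 6/d³ normalises it, and its peak 3/(2d) is below 2/d.
  refine ⟨fun t ↦ max 0 (6 / d ^ 3 * ((t - a) * (a + d - t))), ?_, ?_, ?_, ?_, ?_, ?_, ?_⟩
  · linarith
  · fun_prop
  · exact fun t ↦ le_max_left _ _
  · refine fun t ↦ max_le (by positivity) ?_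
    have h : (t - a) * (a + d - t) ≤ d ^ 2 / 4 := by nlinarith [sq_nonneg (2 * (t - a) - d)]
    calc 6 / d ^ 3 * ((t - a) * (a + d - t)) ≤ 6 / d ^ 3 * (d ^ 2 / 4) := by gcongr
      _ = (3 / 2) / d := by field_simp; norm_num
      _ ≤ 2 / d := by gcongr; norm_num
  · intro t ht
    refine max_eq_left (mul_nonpos_of_nonneg_of_nonpos (by positivity) ?_)
    exact mul_nonpos_of_nonpos_of_nonneg (by linarith) (by linarith)
  · intro t ht
    refine max_eq_left (mul_nonpos_of_nonneg_of_nonpos (by positivity) ?_)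
    exact mul_nonpos_of_nonneg_of_nonpos (by linarith) (by linarith)
  · have h : ∫ t in a..(a + d), max 0 (6 / d ^ 3 * ((t - a) * (a + d - t))) =
        ∫ t in a..(a + d), 6 / d ^ 3 * ((t - a) * (a + d - t)) := by
      refine intervalIntegral.integral_congr fun t ht ↦ max_eq_right ?_
      rw [Set.uIcc_of_le (by linarith)] at ht
      exact mul_nonneg (by positivity) (mul_nonneg (by linarith [ht.1]) (by linarith [ht.2]))
    have hder : ∀ t ∈ Set.uIcc a (a + d),
        HasDerivAt (fun t ↦ 6 / d ^ 3 * (d * (t - a) ^ 2 / 2 - (t - a) ^ 3 / 3))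
          (6 / d ^ 3 * ((t - a) * (a + d - t))) t := fun t _ ↦ by
      have h1 := (hasDerivAt_id t).sub_const a
      have h2 := ((((h1.pow 2).const_mul d).div_const 2).sub ((h1.pow 3).div_const 3)).const_mul
        (6 / d ^ 3)
      refine h2.congr_deriv ?_
      simp only [id, Nat.cast_ofNat]
      ring
    rw [h, intervalIntegral.integral_eq_sub_of_hasDerivAt hder
      (Continuous.intervalIntegrable (by fun_prop) _ _)]
    field_simp
    ring

/-! ### Stein's identity for sums of independent random variables -/

section Stein

variable {Ω : Type*} [MeasurableSpace Ω] {P : Measure Ω} [IsProbabilityMeasure P]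
  {f f' : ℝ → ℝ} {M : ℝ}

lemma abs_sub_sub_mul_le {C : ℝ} (hf : ∀ x, HasDerivAt f (f' x) x) {v x : ℝ}
    (h : ∀ y ∈ Set.uIcc v (v + x), |f' y - f' v| ≤ C) :
    |f (v + x) - f v - x * f' v| ≤ C * |x| := by
  have h1 := Convex.norm_image_sub_le_of_norm_hasDerivWithin_le (f := fun y ↦ f y - y * f' v)
    (f' := fun y ↦ f' y - f' v) (C := C) (s := Set.uIcc v (v + x)) (x := v) (y := v + x)
    (fun y _ ↦ ((hf y).sub (((hasDerivAt_id y).mul_const (f' v)).congr_deriv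
      (one_mul _))).hasDerivWithinAt) h (convex_uIcc _ _) Set.left_mem_uIcc Set.right_mem_uIcc
  simp only [Real.norm_eq_abs, add_sub_cancel_left] at h1
  convert h1 using 2
  ring

/-- The Lipschitz bound is used for small x and the oscillation bound for large x; the latter keeps
the coefficient of the truncated square equal to 1, whatever M is. -/
lemma abs_mul_taylor_le (hf : ∀ x, HasDerivAt f (f' x) x)
    (hlip : ∀ x y, |f' y - f' x| ≤ M * |y - x|) (hosc : ∀ x y, |f' y - f' x| ≤ 1) (hM : 0 ≤ M)
    {ε : ℝ} (hε : 0 ≤ ε) (v x : ℝ) :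
    |x * f (v + x) - x * f v - x ^ 2 * f' v| ≤
      M * ε * x ^ 2 + {y : ℝ | ε ≤ |y|}.indicator (fun y ↦ y ^ 2) x := by
  have hx : x * f (v + x) - x * f v - x ^ 2 * f' v = x * (f (v + x) - f v - x * f' v) := by ring
  rw [hx, abs_mul]
  have key : ∀ C, |f (v + x) - f v - x * f' v| ≤ C * |x| →
      |x| * |f (v + x) - f v - x * f' v| ≤ C * x ^ 2 := fun C hC ↦ by
    refine (mul_le_mul_of_nonneg_left hC (abs_nonneg x)).trans_eq ?_
    rw [← sq_abs x]
    ring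
  have hlip' := key (M * |x|) <| abs_sub_sub_mul_le hf fun y hy ↦
    (hlip v y).trans <| mul_le_mul_of_nonneg_left (by
      simpa using Set.abs_sub_left_of_mem_uIcc hy) hM
  by_cases h : ε ≤ |x|
  · rw [Set.indicator_of_mem (show x ∈ {y : ℝ | ε ≤ |y|} from h)]
    have hosc' := key 1 <| abs_sub_sub_mul_le hf fun y _ ↦ hosc v y
    have := mul_nonneg (mul_nonneg hM hε) (sq_nonneg x)
    linarith
  · rw [Set.indicator_of_notMem (show x ∉ {y : ℝ | ε ≤ |y|} from h), add_zero]
    refine hlip'.trans ?_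
    gcongr
    exact (not_le.1 h).le

/-- Bounded oscillation of f' forces f to grow at most linearly. -/
lemma memLp_comp_of_deriv_osc (hf : ∀ x, HasDerivAt f (f' x) x)
    (hosc : ∀ x y, |f' y - f' x| ≤ 1) {Y : Ω → ℝ} (hY : MemLp Y 2 P) :
    MemLp (fun ω ↦ f (Y ω)) 2 P := by
  have hcont : Continuous f := continuous_iff_continuousAt.2 fun x ↦ (hf x).continuousAt
  have hYa : MemLp (fun ω ↦ |Y ω|) 2 P := hY.abs
  have hg : MemLp (fun ω ↦ |f 0| + (|f' 0| + 1) * |Y ω|) 2 P :=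
    (memLp_const (|f 0|)).add (hYa.const_mul (|f' 0| + 1))
  refine hg.mono' (hcont.comp_aestronglyMeasurable hY.1)
    (.of_forall fun ω ↦ ?_)
  have h := abs_sub_sub_mul_le (v := 0) (x := Y ω) hf fun y _ ↦ hosc 0 y
  rw [zero_add] at h
  have h2 : f (Y ω) = (f (Y ω) - f 0 - Y ω * f' 0) + f 0 + Y ω * f' 0 := by ring
  rw [Real.norm_eq_abs, h2]
  refine (abs_add_three _ _ _).trans ?_
  rw [abs_mul]
  linarith

lemma integral_abs_le_sqrt {X : Ω → ℝ} (hX : MemLp X 2 P) :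
    ∫ ω, |X ω| ∂P ≤ √(∫ ω, X ω ^ 2 ∂P) := by
  refine Real.le_sqrt_of_sq_le ?_
  have h := variance_nonneg (|X|) P
  rw [variance_eq_sub hX.abs] at h
  simpa using h

/-- Independence and centring kill E[X f(V)] and factor E[X² f'(V)], so the Taylor bound applies
with V as base point. Passing from f'(V) to f'(V + X) costs M E|X|, at most M times the standard
deviation of X. -/
lemma abs_integral_stein_le (hf : ∀ x, HasDerivAt f (f' x) x)
    (hlip : ∀ x y, |f' y - f' x| ≤ M * |y - x|) (hosc : ∀ x y, |f' y - f' x| ≤ 1) (hM : 0 ≤ M)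
    {X V : Ω → ℝ} (hXm : Measurable X) (hX : MemLp X 2 P) (hV : MemLp V 2 P)
    (hind : IndepFun X V P) (h0 : ∫ ω, X ω ∂P = 0) {ε : ℝ} (hε : 0 ≤ ε) :
    |∫ ω, X ω * f (V ω + X ω) ∂P - (∫ ω, X ω ^ 2 ∂P) * ∫ ω, f' (V ω + X ω) ∂P| ≤
      (M * ε + M * √(∫ ω, X ω ^ 2 ∂P)) * (∫ ω, X ω ^ 2 ∂P) +
        ∫ ω in {ω | ε ≤ |X ω|}, X ω ^ 2 ∂P := by
  have hcont : Continuous f := continuous_iff_continuousAt.2 fun x ↦ (hf x).continuousAt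
  have hcont' : Continuous f' := by
    refine (LipschitzWith.of_dist_le_mul (K := M.toNNReal) fun x y ↦ ?_).continuous
    rw [Real.dist_eq, Real.dist_eq, Real.coe_toNNReal _ hM]
    exact hlip y x
  have hbdd : ∀ x, ‖f' x‖ ≤ |f' 0| + 1 := fun x ↦ by
    have := abs_add_le (f' x - f' 0) (f' 0)
    rw [sub_add_cancel] at this
    rw [Real.norm_eq_abs]
    linarith [hosc 0 x]
  have hVX : MemLp (fun ω ↦ V ω + X ω) 2 P := hV.add hX
  have hXsq : Integrable (fun ω ↦ X ω ^ 2) P := hX.integrable_sq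
  have hint' : ∀ {Y : Ω → ℝ}, MemLp Y 2 P → Integrable (fun ω ↦ f' (Y ω)) P := fun hY ↦
    Integrable.of_bound (hcont'.comp_aestronglyMeasurable hY.1) _ (.of_forall fun ω ↦ hbdd _)
  have hi₁ : Integrable (fun ω ↦ X ω * f (V ω + X ω)) P :=
    hX.integrable_mul (memLp_comp_of_deriv_osc hf hosc hVX)
  have hi₂ : Integrable (fun ω ↦ X ω * f (V ω)) P :=
    hX.integrable_mul (memLp_comp_of_deriv_osc hf hosc hV)
  have hi₃ : Integrable (fun ω ↦ X ω ^ 2 * f' (V ω)) P :=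
    hXsq.mul_bdd (hcont'.comp_aestronglyMeasurable hV.1) (.of_forall fun ω ↦ hbdd _)
  have hi₁₂ : Integrable (fun ω ↦ X ω * f (V ω + X ω) - X ω * f (V ω)) P := hi₁.sub hi₂
  have hset : MeasurableSet {y : ℝ | ε ≤ |y|} := measurableSet_le measurable_const (by fun_prop)
  have e₂ : ∫ ω, X ω * f (V ω) ∂P = 0 := by
    have hi := hind.comp measurable_id hcont.measurable
    have := hi.integral_fun_mul_eq_mul_integral hX.1 (hcont.comp_aestronglyMeasurable hV.1)
    simpa [h0] using this
  have e₃ : ∫ ω, X ω ^ 2 * f' (V ω) ∂P = (∫ ω, X ω ^ 2 ∂P) * ∫ ω, f' (V ω) ∂P := by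
    have hi := hind.comp (measurable_id.pow_const 2) hcont'.measurable
    exact hi.integral_fun_mul_eq_mul_integral hXsq.1 (hcont'.comp_aestronglyMeasurable hV.1)
  have b₁ : |∫ ω, X ω * f (V ω + X ω) ∂P - (∫ ω, X ω ^ 2 ∂P) * ∫ ω, f' (V ω) ∂P| ≤
      M * ε * (∫ ω, X ω ^ 2 ∂P) + ∫ ω in {ω | ε ≤ |X ω|}, X ω ^ 2 ∂P := by
    have hs : MeasurableSet {ω | ε ≤ |X ω|} := hXm hset
    have hbound : Integrable
        (fun ω ↦ M * ε * X ω ^ 2 + {ω | ε ≤ |X ω|}.indicator (fun ω ↦ X ω ^ 2) ω) P :=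
      (hXsq.const_mul _).add (hXsq.indicator hs)
    have e : ∫ ω, X ω * f (V ω + X ω) ∂P - (∫ ω, X ω ^ 2 ∂P) * ∫ ω, f' (V ω) ∂P =
        ∫ ω, (X ω * f (V ω + X ω) - X ω * f (V ω) - X ω ^ 2 * f' (V ω)) ∂P := by
      rw [integral_sub hi₁₂ hi₃, integral_sub hi₁ hi₂, e₂, e₃, sub_zero]
    rw [e, ← integral_const_mul, ← integral_indicator hs,
      ← integral_add (hXsq.const_mul _) (hXsq.indicator hs)]
    rw [← Real.norm_eq_abs]
    refine norm_integral_le_of_norm_le hbound (.of_forall fun ω ↦ ?_)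
    exact abs_mul_taylor_le hf hlip hosc hM hε (V ω) (X ω)
  have b₂ : |∫ ω, f' (V ω + X ω) ∂P - ∫ ω, f' (V ω) ∂P| ≤ M * √(∫ ω, X ω ^ 2 ∂P) := by
    rw [← integral_sub (hint' hVX) (hint' hV), ← Real.norm_eq_abs]
    have hXa : Integrable (fun ω ↦ |X ω|) P := (hX.integrable one_le_two).abs
    refine (norm_integral_le_of_norm_le (hXa.const_mul M) (.of_forall fun ω ↦ ?_)).trans ?_
    · simpa using hlip (V ω) (V ω + X ω)
    · rw [integral_const_mul]
      exact mul_le_mul_of_nonneg_left (integral_abs_le_sqrt hX) hM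
  have hσ : 0 ≤ ∫ ω, X ω ^ 2 ∂P := integral_nonneg fun ω ↦ sq_nonneg _
  have b₃ := mul_le_mul_of_nonneg_left b₂ hσ
  rw [← abs_of_nonneg hσ, ← abs_mul, abs_of_nonneg hσ] at b₃
  have hsplit : ∫ ω, X ω * f (V ω + X ω) ∂P - (∫ ω, X ω ^ 2 ∂P) * ∫ ω, f' (V ω + X ω) ∂P =
      (∫ ω, X ω * f (V ω + X ω) ∂P - (∫ ω, X ω ^ 2 ∂P) * ∫ ω, f' (V ω) ∂P) -
      (∫ ω, X ω ^ 2 ∂P) * (∫ ω, f' (V ω + X ω) ∂P - ∫ ω, f' (V ω) ∂P) := by ring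
  rw [hsplit]
  refine (abs_sub _ _).trans ?_
  linarith

/-- A quantitative form of Stein's identity for a sum of independent centred random variables
whose variances add up to `1`. -/
lemma abs_integral_stein_sum_le {ι : Type*} [Fintype ι] (hf : ∀ x, HasDerivAt f (f' x) x)
    (hlip : ∀ x y, |f' y - f' x| ≤ M * |y - x|) (hosc : ∀ x y, |f' y - f' x| ≤ 1) (hM : 0 ≤ M)
    {X : ι → Ω → ℝ} (hXm : ∀ k, Measurable (X k)) (hX : ∀ k, MemLp (X k) 2 P)
    (hind : iIndepFun X P) (h0 : ∀ k, ∫ ω, X k ω ∂P = 0) (h1 : ∑ k, ∫ ω, X k ω ^ 2 ∂P = 1)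
    {s ε : ℝ} (hs : ∀ k, ∫ ω, X k ω ^ 2 ∂P ≤ s) (hε : 0 ≤ ε) :
    |∫ ω, (f' (∑ k, X k ω) - (∑ k, X k ω) * f (∑ k, X k ω)) ∂P| ≤
      M * ε + M * √s + ∑ k, ∫ ω in {ω | ε ≤ |X k ω|}, X k ω ^ 2 ∂P := by
  classical
  have hW : MemLp (fun ω ↦ ∑ k, X k ω) 2 P := memLp_finsetSum _ fun k _ ↦ hX k
  have hfW := memLp_comp_of_deriv_osc hf hosc hW
  have hcont' : Continuous f' := by
    refine (LipschitzWith.of_dist_le_mul (K := M.toNNReal) fun x y ↦ ?_).continuous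
    rw [Real.dist_eq, Real.dist_eq, Real.coe_toNNReal _ hM]
    exact hlip y x
  have hif' : Integrable (fun ω ↦ f' (∑ k, X k ω)) P := by
    refine Integrable.of_bound (hcont'.comp_aestronglyMeasurable hW.1) (|f' 0| + 1)
      (.of_forall fun ω ↦ ?_)
    have := abs_add_le (f' (∑ k, X k ω) - f' 0) (f' 0)
    rw [sub_add_cancel] at this
    rw [Real.norm_eq_abs]
    linarith [hosc 0 (∑ k, X k ω)]
  have hiWf : Integrable (fun ω ↦ (∑ k, X k ω) * f (∑ k, X k ω)) P := hW.integrable_mul hfW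
  have hiXf : ∀ k, Integrable (fun ω ↦ X k ω * f (∑ j, X j ω)) P :=
    fun k ↦ (hX k).integrable_mul hfW
  have key : ∀ k, |∫ ω, X k ω * f (∑ j, X j ω) ∂P -
      (∫ ω, X k ω ^ 2 ∂P) * ∫ ω, f' (∑ j, X j ω) ∂P| ≤
      (M * ε + M * √s) * (∫ ω, X k ω ^ 2 ∂P) + ∫ ω in {ω | ε ≤ |X k ω|}, X k ω ^ 2 ∂P := by
    intro k
    have hV : MemLp (fun ω ↦ ∑ j ∈ Finset.univ.erase k, X j ω) 2 P :=
      memLp_finsetSum _ fun j _ ↦ hX j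
    have hi : IndepFun (X k) (fun ω ↦ ∑ j ∈ Finset.univ.erase k, X j ω) P := by
      have := (hind.indepFun_finsetSum_of_notMem hXm (Finset.notMem_erase k Finset.univ)).symm
      rwa [Finset.sum_fn] at this
    have h := abs_integral_stein_le hf hlip hosc hM (hXm k) (hX k) hV hi (h0 k) hε
    simp only [Finset.sum_erase_add _ _ (Finset.mem_univ k)] at h
    refine h.trans ?_
    have hσ : 0 ≤ ∫ ω, X k ω ^ 2 ∂P := integral_nonneg fun ω ↦ sq_nonneg _
    gcongr
    exact hs k
  have e : ∫ ω, (f' (∑ k, X k ω) - (∑ k, X k ω) * f (∑ k, X k ω)) ∂P =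
      -∑ k, (∫ ω, X k ω * f (∑ j, X j ω) ∂P -
        (∫ ω, X k ω ^ 2 ∂P) * ∫ ω, f' (∑ j, X j ω) ∂P) := by
    rw [integral_sub hif' hiWf, Finset.sum_sub_distrib, ← Finset.sum_mul, h1,
      one_mul, ← integral_finsetSum _ fun k _ ↦ hiXf k]
    simp only [Finset.sum_mul, neg_sub]
  rw [e, abs_neg]
  refine (Finset.abs_sum_le_sum_abs _ _).trans ((Finset.sum_le_sum fun k _ ↦ key k).trans_eq ?_)
  rw [Finset.sum_add_distrib, ← Finset.mul_sum, h1, mul_one]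

/-- The distribution function of a sum of independent centred random variables whose variances add
up to `1` is close to the standard normal one. -/
lemma abs_measureReal_sub_stdCdf_le {ι : Type*} [Fintype ι]
    {X : ι → Ω → ℝ} (hXm : ∀ k, Measurable (X k)) (hX : ∀ k, MemLp (X k) 2 P)
    (hind : iIndepFun X P) (h0 : ∀ k, ∫ ω, X k ω ∂P = 0) (h1 : ∑ k, ∫ ω, X k ω ^ 2 ∂P = 1)
    {s ε d : ℝ} (hs : ∀ k, ∫ ω, X k ω ^ 2 ∂P ≤ s) (hε : 0 ≤ ε) (hd : 0 < d) (x : ℝ) :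
    |P.real {ω | ∑ k, X k ω ≤ x} - stdCdf x| ≤
      d + 2 / d * ε + 2 / d * √s + ∑ k, ∫ ω in {ω | ε ≤ |X k ω|}, X k ω ^ 2 ∂P := by
  have hWm : Measurable fun ω ↦ ∑ k, X k ω := Finset.measurable_sum _ fun k _ ↦ hXm k
  have hms : MeasurableSet {ω | ∑ k, X k ω ≤ x} := measurableSet_le hWm measurable_const
  have hstep : ∀ {m : ℝ → ℝ} {a b M : ℝ}, IsBumpDensity m a b M →
      Integrable (fun ω ↦ smoothStep m b (∑ k, X k ω)) P ∧
      |∫ ω, smoothStep m b (∑ k, X k ω) ∂P - smoothCdf m a b| ≤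
        M * ε + M * √s + ∑ k, ∫ ω in {ω | ε ≤ |X k ω|}, X k ω ^ 2 ∂P := by
    intro m a b M hm
    have hc : Continuous (smoothStep m b) := by
      have : smoothStep m b = fun w ↦ -∫ t in b..w, m t :=
        funext fun w ↦ intervalIntegral.integral_symm _ _
      rw [this]
      exact (continuous_iff_continuousAt.2 fun w ↦
        (hm.continuous.integral_hasStrictDerivAt b w).hasDerivAt.continuousAt).neg
    have hint : Integrable (fun ω ↦ smoothStep m b (∑ k, X k ω)) P := by
      refine Integrable.of_bound (hc.measurable.comp hWm).aestronglyMeasurable 1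
        (.of_forall fun ω ↦ ?_)
      rw [Real.norm_of_nonneg (hm.smoothStep_nonneg _)]
      exact hm.smoothStep_le_one _
    refine ⟨hint, ?_⟩
    have h := abs_integral_stein_sum_le hm.hasDerivAt_steinSol hm.abs_steinSolDeriv_sub_le
      hm.abs_steinSolDeriv_sub_le_one hm.bound_nonneg hXm hX hind h0 h1 hs hε
    simp only [hm.stein_equation] at h
    rwa [integral_sub hint (integrable_const _), integral_const, probReal_univ, one_smul] at h
  have hP : P.real {ω | ∑ k, X k ω ≤ x} =
      ∫ ω, {ω | ∑ k, X k ω ≤ x}.indicator (fun _ ↦ (1 : ℝ)) ω ∂P := by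
    rw [integral_indicator_const _ hms, smul_eq_mul, mul_one]
  have hiP : Integrable ({ω | ∑ k, X k ω ≤ x}.indicator fun _ ↦ (1 : ℝ)) P :=
    (integrable_const _).indicator hms
  -- Smoothing over [x, x + d] gives a majorant of the indicator of (-∞, x], and smoothing over [x -
  -- d, x] a minorant.
  obtain ⟨m, hm⟩ := exists_isBumpDensity x hd
  obtain ⟨m', hm'⟩ := exists_isBumpDensity (x - d) hd
  rw [sub_add_cancel] at hm'
  obtain ⟨hi, hb⟩ := hstep hm
  obtain ⟨hi', hb'⟩ := hstep hm'
  have hup : P.real {ω | ∑ k, X k ω ≤ x} ≤ ∫ ω, smoothStep m (x + d) (∑ k, X k ω) ∂P := by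
    rw [hP]
    refine integral_mono hiP hi fun ω ↦ ?_
    by_cases h : ∑ k, X k ω ≤ x
    · rw [Set.indicator_of_mem (show ω ∈ {ω | ∑ k, X k ω ≤ x} from h)]
      exact (hm.smoothStep_eq_one h).ge
    · rw [Set.indicator_of_notMem (show ω ∉ {ω | ∑ k, X k ω ≤ x} from h)]
      exact hm.smoothStep_nonneg _
  have hlow : ∫ ω, smoothStep m' x (∑ k, X k ω) ∂P ≤ P.real {ω | ∑ k, X k ω ≤ x} := by
    rw [hP]
    refine integral_mono hi' hiP fun ω ↦ ?_
    by_cases h : ∑ k, X k ω ≤ x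
    · rw [Set.indicator_of_mem (show ω ∈ {ω | ∑ k, X k ω ≤ x} from h)]
      exact hm'.smoothStep_le_one _
    · rw [Set.indicator_of_notMem (show ω ∉ {ω | ∑ k, X k ω ≤ x} from h)]
      exact (hm'.smoothStep_eq_zero (not_le.1 h).le).le
  have c₁ := hm.smoothCdf_le.trans (stdCdf_add_le x hd.le)
  have c₂ := stdCdf_add_le (x - d) hd.le
  rw [sub_add_cancel] at c₂
  have c₃ := hm'.le_smoothCdf
  rw [abs_le] at hb hb' ⊢
  constructor <;> linarith [hb.2, hb'.1]

end Stein

/-! ### Passage to the limit -/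

lemma measureReal_le_eq_stdCdf {Ω' : Type*} [MeasurableSpace Ω'] {P' : Measure Ω'}
    {ξ : Ω' → ℝ} (hξ : HasLaw ξ (gaussianReal 0 1) P') (x : ℝ) :
    P'.real {ω | ξ ω ≤ x} = stdCdf x := by
  rw [stdCdf, cdf_eq_real]
  exact hξ.measureReal_eq measurableSet_Iic

theorem theorem2p7 {Ω : ℕ → Type*} [∀ n, MeasurableSpace (Ω n)]
    (P : ∀ n, Measure (Ω n)) [∀ n, IsProbabilityMeasure (P n)]
    (X : ∀ n, Fin n → Ω n → ℝ)
    (hX : IsStandardTriangularArray P X) (hF : FellerNegligible P X)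
    {Ω' : Type*} [MeasurableSpace Ω'] (P' : Measure Ω') [IsProbabilityMeasure P']
    (ξ : Ω' → ℝ) (hξ : HasLaw ξ (gaussianReal 0 1) P') :
    limsup (fun n ↦ kolmogorovDist P' ξ (P n) (fun ω ↦ ∑ k, X n k ω)) atTop
      ≤ lindebergIndex P X := by
  have hΛ0 : ∀ (ε : ℝ) n, 0 ≤ ∑ k, ∫ ω in {ω | ε ≤ |X n k ω|}, X n k ω ^ 2 ∂(P n) :=
    fun ε n ↦ Finset.sum_nonneg fun k _ ↦ integral_nonneg fun ω ↦ sq_nonneg _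
  have hΛ1 : ∀ (ε : ℝ) n, ∑ k, ∫ ω in {ω | ε ≤ |X n k ω|}, X n k ω ^ 2 ∂(P n) ≤ 1 := by
    intro ε n
    rcases Nat.eq_zero_or_pos n with rfl | hn
    · simp
    · rw [← hX.sum_variance n hn]
      exact Finset.sum_le_sum fun k _ ↦ setIntegral_le_integral
        (hX.memLp_two n hn k).integrable_sq (.of_forall fun ω ↦ sq_nonneg _)
  have hbdd : ∀ ε : ℝ, IsBoundedUnder (· ≤ ·) atTop
      (fun n ↦ ∑ k, ∫ ω in {ω | ε ≤ |X n k ω|}, X n k ω ^ 2 ∂(P n)) := fun ε ↦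
    isBoundedUnder_of ⟨1, hΛ1 ε⟩
  have hcobdd : ∀ ε : ℝ, IsCoboundedUnder (· ≤ ·) atTop
      (fun n ↦ ∑ k, ∫ ω in {ω | ε ≤ |X n k ω|}, X n k ω ^ 2 ∂(P n)) := fun ε ↦
    (isBoundedUnder_of ⟨0, hΛ0 ε⟩ : IsBoundedUnder (· ≥ ·) atTop _).isCoboundedUnder_le
  have hLin : ∀ ε : ℝ, 0 < ε →
      limsup (fun n ↦ ∑ k, ∫ ω in {ω | ε ≤ |X n k ω|}, X n k ω ^ 2 ∂(P n)) atTop ≤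
        lindebergIndex P X := by
    intro ε hε
    -- The bound 1 is needed because a supremum of an unbounded family of reals would take the
    -- default value 0.
    refine le_ciSup (f := fun ε : Set.Ioi (0 : ℝ) ↦ limsup
      (fun n ↦ ∑ k, ∫ ω in {ω | (ε : ℝ) ≤ |X n k ω|}, X n k ω ^ 2 ∂(P n)) atTop)
      ⟨1, ?_⟩ (⟨ε, hε⟩ : Set.Ioi (0 : ℝ))
    rintro _ ⟨ε, rfl⟩
    exact limsup_le_of_le (hcobdd ε) (.of_forall (hΛ1 ε))
  have hK0 : ∀ n, 0 ≤ kolmogorovDist P' ξ (P n) (fun ω ↦ ∑ k, X n k ω) :=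
    fun n ↦ Real.iSup_nonneg fun x ↦ abs_nonneg _
  refine le_of_forall_pos_le_add fun η hη ↦ ?_
  refine limsup_le_of_le
    (isBoundedUnder_of ⟨0, hK0⟩ : IsBoundedUnder (· ≥ ·) atTop _).isCoboundedUnder_le ?_
  -- The error η is split into four: smoothing width d = η/4, the term (2/d)ε = η/4 for ε = d²/2,
  -- the Feller term, and the excess of the Lindeberg sum over the index.
  have hd : 0 < η / 4 := by positivity
  have hε : 0 < (η / 4) ^ 2 / 2 := by positivity
  have hev₁ := eventually_lt_of_limsup_lt
    ((hLin _ hε).trans_lt (lt_add_of_pos_right _ hd)) (hbdd _)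
  have hev₂ : ∀ᶠ n in atTop, 2 / (η / 4) * √(⨆ k, ∫ ω, X n k ω ^ 2 ∂(P n)) < η / 4 := by
    have h : Tendsto (fun n ↦ 2 / (η / 4) * √(⨆ k, ∫ ω, X n k ω ^ 2 ∂(P n))) atTop
        (𝓝 (2 / (η / 4) * √0)) := ((Real.continuous_sqrt.tendsto 0).comp hF).const_mul _
    rw [Real.sqrt_zero, mul_zero] at h
    exact h.eventually_lt_const hd
  filter_upwards [hev₁, hev₂, eventually_ge_atTop 1] with n h₁ h₂ hn
  refine ciSup_le fun x ↦ ?_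
  rw [measureReal_le_eq_stdCdf hξ, abs_sub_comm]
  refine (abs_measureReal_sub_stdCdf_le (hX.measurable n hn) (hX.memLp_two n hn) (hX.indep n hn)
    (hX.mean_zero n hn) (hX.sum_variance n hn)
    (fun k ↦ le_ciSup (f := fun k ↦ ∫ ω, X n k ω ^ 2 ∂(P n)) (Set.finite_range _).bddAbove k)
    hε.le hd x).trans ?_
  have h₃ : 2 / (η / 4) * ((η / 4) ^ 2 / 2) = η / 4 := by
    field_simp
  linarith
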